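/- Let $f,g_1,\dots,g_m:\mathbb R^n\to\mathbb R$ be convex and continuously differentiable with locally Lipschitz gradients, let $A\in\mathbb R^{r\times n}$ and $b\in\mathbb R^r$, and suppose that the feasible set $\{x : g(x)\le 0,\ Ax-b=0\}$ of the problem of minimizing $f(x)$ subject to $g(x)\le 0$ and $Ax-b=0$ is nonempty and that $f$ attains a minimum on it. Let $\chi^*$ be the set of KKT triples, i.e. of all $(x^*,\mu^*,\lambda^*)\in\mathbb R^n\times\mathbb R^r\times\mathbb R^m_{\ge 0}$ with $$\nabla f(x^*)+\sum_{l=1}^m\lambda^*_l\nabla g_l(x^*)+A^\top\mu^*=0,\quad Ax^*-b=0,\quad g(x^*)\le 0,\quad \lambda_l^*g_l(x^*)=0\ (l=1,\dots,m),$$ and suppose that $\chi^*\ne\emptyset$ (for instance because a constraint qualification holds). Consider the generalized primal-dual dynamics $x=M(s)v$, $\mu=H(s)h$, $\lambda=G^+(s)w$ with $$v=-\nabla f(x)-\sum_{l}\lambda_l\nabla g_l(x)-A^\top\mu,\qquad h=Ax-b,\qquad w=g(x),$$ where $M(s)$, $H(s)$, $G^+(s)$ are diagonal with entries $$M_i(s)=\frac{c_{i1}}{s}+\sum_{k=2}^{n_i}\frac{c_{ik}}{s+a_{ik}}+d_i,\quad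 H_j(s)=\frac{\bar c_{j1}}{s}+\sum_{q=2}^{r_j}\frac{\bar c_{jq}}{s+\bar a_{jq}}+\bar d_j,\quad G^+_l(s)=\Big(\frac{\hat c_{l1}}{s}\Big)^+ +\sum_{p=2}^{m_l}\Big(\frac{\hat c_{lp}}{s+\hat a_{lp}}\Big)^+ +(\hat d_l)^+,$$ with $n_i,r_j,m_l\ge 1$, $0<a_{i2}<\dots<a_{in_i}$, $0<\bar a_{j2}<\dots<\bar a_{jr_j}$, $0<\hat a_{l2}<\dots<\hat a_{lm_l}$, all $c_{ik},\bar c_{jq},\hat c_{lp}>0$, and $d_i,\bar d_j,\hat d_l\ge 0$. Put $a_{i1}=\bar a_{j1}=\hat a_{l1}=0$. In state-space form, for $t\ge 0$, $$\dot\xi_{ik}=-a_{ik}\xi_{ik}+c_{ik}v_i,\qquad x_i=\sum_{k=1}^{n_i}\xi_{ik}+d_iv_i,$$ $$\dot\zeta_{jq}=-\bar a_{jq}\zeta_{jq}+\bar c_{jq}h_j,\qquad \mu_j=\sum_{q=1}^{r_j}\zeta_{jq}+\bar d_jh_j,$$ $$\dot\rho_{lp}=[-\hat a_{lp}\rho_{lp}+\hat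 c_{lp}w_l]^+_{\rho_{lp}},\quad \rho_{lp}\ge 0,\qquad \lambda_l=\sum_{p=1}^{m_l}\rho_{lp}+\hat d_l\max\{0,w_l\},$$ where $[\sigma]^+_\varepsilon=0$ if $\varepsilon=0$ and $\sigma<0$, and $[\sigma]^+_\varepsilon=\sigma$ otherwise. A trajectory is a Carathéodory solution on $[0,\infty)$: the states $\xi,\zeta,\rho$ are locally absolutely continuous and satisfy the differential equations for almost every $t$, while the constraint $\rho\ge 0$ and the output equations hold for all $t\ge 0$. If the cost function $f$ is strictly convex, then, with no condition on the zeros of the $M_i(s)$, along every trajectory (with any initial state) $(x(t),\mu(t),\lambda(t))$ converges, as $t\to\infty$, to a point of $\chi^*$. -/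

import Mathlib

open MeasureTheory Set Filter Topology
open scoped Gradient

namespace PrimalDual

/-- The data of the program: minimize `f x` subject to `g x ≤ 0` and `A x - b = 0`, with
`n` variables, `m` inequality constraints and `r` equality constraints. -/
structure Program (n m r : ℕ) where
  /-- the cost function -/
  f : EuclideanSpace ℝ (Fin n) → ℝ
  /-- the components of the inequality constraint function -/
  g : Fin m → EuclideanSpace ℝ (Fin n) → ℝ
  /-- the matrix of the equality constraint -/
  A : Matrix (Fin r) (Fin n) ℝ
  /-- the right-hand side of the equality constraint -/
  b : EuclideanSpace ℝ (Fin r)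

namespace Program

variable {n m r : ℕ} (P : Program n m r)

/-- The feasible set. -/
def feasible : Set (EuclideanSpace ℝ (Fin n)) :=
  {x | (∀ l, P.g l x ≤ 0) ∧ P.A.toEuclideanLin x - P.b = 0}

/-- The standing assumption on the program: convex, continuously differentiable data with
locally Lipschitz gradients, a nonempty feasible set, and an attained minimum on it. -/
structure Assumption : Prop where
  convex_f : ConvexOn ℝ univ P.f
  convex_g : ∀ l, ConvexOn ℝ univ (P.g l)
  contDiff_f : ContDiff ℝ 1 P.f
  contDiff_g : ∀ l, ContDiff ℝ 1 (P.g l)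
  lipschitz_f : LocallyLipschitz (∇ P.f)
  lipschitz_g : ∀ l, LocallyLipschitz (∇ (P.g l))
  feasible_nonempty : P.feasible.Nonempty
  exists_min : ∃ x ∈ P.feasible, IsMinOn P.f P.feasible x

/-- The signal `v = -∇f(x) - ∇g(x) λ - Aᵀ μ`, where `∇g(x) λ = ∑ l, λ l • ∇(g l)(x)`. -/
noncomputable def v (x : EuclideanSpace ℝ (Fin n)) (mu : EuclideanSpace ℝ (Fin r))
    (lam : EuclideanSpace ℝ (Fin m)) : EuclideanSpace ℝ (Fin n) :=
  -∇ P.f x - ∑ l, lam l • ∇ (P.g l) x - P.A.transpose.toEuclideanLin mu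

/-- The signal `h = A x - b`. -/
noncomputable def h (x : EuclideanSpace ℝ (Fin n)) : EuclideanSpace ℝ (Fin r) :=
  P.A.toEuclideanLin x - P.b

/-- The set `χ*` of KKT triples `(x*, μ*, λ*)`. -/
def kktSet :
    Set (EuclideanSpace ℝ (Fin n) × EuclideanSpace ℝ (Fin r) × EuclideanSpace ℝ (Fin m)) :=
  {p | ∇ P.f p.1 + ∑ l, p.2.2 l • ∇ (P.g l) p.1 + P.A.transpose.toEuclideanLin p.2.1 = 0 ∧
    P.A.toEuclideanLin p.1 - P.b = 0 ∧
    (∀ l, 0 ≤ p.2.2 l) ∧ (∀ l, P.g l p.1 ≤ 0) ∧ (∀ l, p.2.2 l * P.g l p.1 = 0)}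

end Program

/-- The parameters of a scalar transfer function
`c 0 / s + ∑ k ≥ 1, c k / (s + a k) + d` with `k` running up to `lags`, where
`0 = a 0 < a 1 < ⋯ < a lags`, all `c k` are positive and `d ≥ 0`.
There may be no lag term at all (`lags = 0`). -/
structure Block where
  /-- the number of first-order lag terms besides the integrator -/
  lags : ℕ
  /-- minus the poles; the first one is the pole of the integrator -/
  a : Fin (lags + 1) → ℝ
  /-- the gains -/
  c : Fin (lags + 1) → ℝ
  /-- the feedthrough gain -/
  d : ℝ
  a_zero : a 0 = 0
  a_strictMono : StrictMono a
  c_pos : ∀ k, 0 < c k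
  d_nonneg : 0 ≤ d

/-- The operator `[σ]⁺_ε`: zero if `ε = 0` and `σ < 0`, and `σ` otherwise. -/
noncomputable def proj (ε σ : ℝ) : ℝ := open Classical in if ε = 0 ∧ σ < 0 then 0 else σ

/-- `s` is a Carathéodory solution on `[0, ∞)` of `ṡ(t) = F(t)`: it is absolutely continuous on
every compact interval `[0, T]`, and the equation holds at almost every time. The right-hand
side `F` is the vector field evaluated along the trajectory under consideration. -/
def Caratheodory (s F : ℝ → ℝ) : Prop :=
  (∀ T : ℝ, 0 < T → AbsolutelyContinuousOnInterval s 0 T) ∧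
    ∀ᵐ t : ℝ, 0 < t → HasDerivAt s (F t) t

/-- The state-space realization of the linear block `B`, with input `u`, output `y` and
state `s`: `ṡ k = -a k * s k + c k * u` and `y = ∑ k, s k + d * u`. -/
structure Block.Linear (B : Block) (u y : ℝ → ℝ) (s : ℝ → Fin (B.lags + 1) → ℝ) : Prop where
  state : ∀ k, Caratheodory (fun t => s t k) (fun t => -B.a k * s t k + B.c k * u t)
  output : ∀ t, 0 ≤ t → y t = ∑ k, s t k + B.d * u t

/-- The block `B` with each of its terms constrained to be nonnegative:
the state lives in the nonnegative orthant, `ṡ k = [-a k * s k + c k * u]⁺_(s k)` and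
`y = ∑ k, s k + d * max 0 u`. -/
structure Block.Projected (B : Block) (u y : ℝ → ℝ) (s : ℝ → Fin (B.lags + 1) → ℝ) : Prop where
  nonneg : ∀ t, 0 ≤ t → ∀ k, 0 ≤ s t k
  state : ∀ k, Caratheodory (fun t => s t k)
    (fun t => proj (s t k) (-B.a k * s t k + B.c k * u t))
  output : ∀ t, 0 ≤ t → y t = ∑ k, s t k + B.d * max 0 (u t)

/-- `(x, mu, lam)` with states `(ξ, ζ, ρ)` is a trajectory on `[0, ∞)` of the generalized
primal-dual dynamics `x = M v`, `μ = H h`, `λ = G⁺ g(x)` with diagonal `M`, `H` and `G⁺`. -/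
structure IsTrajectory {n m r : ℕ} (P : Program n m r)
    (M : Fin n → Block) (H : Fin r → Block) (G : Fin m → Block)
    (x : ℝ → EuclideanSpace ℝ (Fin n)) (mu : ℝ → EuclideanSpace ℝ (Fin r))
    (lam : ℝ → EuclideanSpace ℝ (Fin m))
    (ξ : ∀ i, ℝ → Fin ((M i).lags + 1) → ℝ) (ζ : ∀ j, ℝ → Fin ((H j).lags + 1) → ℝ)
    (ρ : ∀ l, ℝ → Fin ((G l).lags + 1) → ℝ) : Prop where
  primal : ∀ i, (M i).Linear (fun t => P.v (x t) (mu t) (lam t) i) (fun t => x t i) (ξ i)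
  dual_eq : ∀ j, (H j).Linear (fun t => P.h (x t) j) (fun t => mu t j) (ζ j)
  dual_ineq : ∀ l, (G l).Projected (fun t => P.g l (x t)) (fun t => lam t l) (ρ l)

end PrimalDual

/-!
The proof is a Lyapunov argument that replaces LaSalle's invariance principle by Barbalat's lemma.

Every block is dissipative: half the sum of the squared distances of its states to their rest
values, weighted by the inverse gains (`storage`), grows at most at the rate of the power supplied
by its input, less the losses `a k / c k * (s k) ^ 2` of the lags and the loss in the feedthrough;
the projection in the blocks of `λ` only helps (`storage_deriv_le`). The blocks are interconnected
through the saddle operator of the Lagrangian, which is monotone (`Program.saddle_monotone`).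
Hence, relative to any KKT triple `(x*, μ*, λ*)`, the total storage decays at a rate which is at
least a sum of nonnegative terms (`dissipation`): the losses of the lags, `d i * (v i) ^ 2`,
`⟪∇f x - ∇f x*, x - x*⟫`, and `-λ l * g l x*`.

So the state is bounded. With feedthrough, `x` is given only implicitly, by `x = ∑ ξ + D v`, but
monotonicity of `-v` in `x` makes it depend on the state through an explicit modulus
(`abs_sub_le_modulus`). Therefore `x` is bounded, the states are Lipschitz in time, and all signals
are uniformly continuous. Barbalat's lemma sends each term of the dissipation to zero. By strict
convexity of `f` this gives `x → x*`; the integrator states of the primal blocks then converge, and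
Barbalat's lemma gives `v → 0` (`IsRun.tendsto_v`), whatever the zeros of the transfer functions.

Consequently every cluster point of the state is an equilibrium, and its outputs form a KKT triple
(`IsRun.snd_eq_equilibrium`, `IsRun.tripleOut_mem_kktSet`). The storage function relative to that
triple is also nonincreasing and has `0` as a cluster value, so it tends to zero: the state
converges to the cluster point (`IsRun.tendsto_of_mapClusterPt`).
-/

namespace PrimalDual

/-! ### Differential inequalities for locally absolutely continuous functions -/

/-- Absolute continuity on every interval `[0, T]`, as in `Caratheodory`. -/
def LocAC (f : ℝ → ℝ) : Prop := ∀ T : ℝ, 0 < T → AbsolutelyContinuousOnInterval f 0 T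

theorem LocAC.on {f : ℝ → ℝ} (hf : LocAC f) {a b : ℝ} (ha : 0 ≤ a) (hb : 0 ≤ b) :
    AbsolutelyContinuousOnInterval f a b := by
  refine (hf (max a b + 1) (by linarith [le_max_left a b])).mono ?_
  have h0 : 0 ≤ max a b + 1 := by linarith [le_max_left a b]
  intro t ht
  rw [uIcc_of_le h0]
  rw [mem_uIcc] at ht
  have := le_max_left a b
  have := le_max_right a b
  constructor <;> rcases ht with h | h <;> linarith [h.1, h.2]

theorem LocAC.neg {f : ℝ → ℝ} (hf : LocAC f) : LocAC fun t => -f t :=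
  fun T hT => (hf T hT).neg

theorem LocAC.add {f g : ℝ → ℝ} (hf : LocAC f) (hg : LocAC g) : LocAC fun t => f t + g t :=
  fun T hT => (hf T hT).add (hg T hT)

theorem LocAC.mul {f g : ℝ → ℝ} (hf : LocAC f) (hg : LocAC g) : LocAC fun t => f t * g t :=
  fun T hT => (hf T hT).mul (hg T hT)

theorem locAC_const (c : ℝ) : LocAC fun _ => c := fun T _ =>
  ((LipschitzWith.const c).lipschitzOnWith (s := uIcc 0 T)).absolutelyContinuousOnInterval

theorem LocAC.sum {ι : Type*} (s : Finset ι) {f : ι → ℝ → ℝ} (hf : ∀ i ∈ s, LocAC (f i)) :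
    LocAC fun t => ∑ i ∈ s, f i t := by
  classical
  induction s using Finset.induction_on with
  | empty => simpa using locAC_const 0
  | insert i s hi ih =>
    simp only [Finset.sum_insert hi]
    exact (hf i (Finset.mem_insert_self i s)).add
      (ih fun j hj => hf j (Finset.mem_insert_of_mem hj))

theorem mul_sub_le_sub_of_ae_le_deriv {f : ℝ → ℝ} (hf : LocAC f) {a b c : ℝ} (ha : 0 ≤ a)
    (hab : a ≤ b) (h : ∀ᵐ t : ℝ, t ∈ Ioc a b → ∃ D, HasDerivAt f D t ∧ c ≤ D) :
    c * (b - a) ≤ f b - f a := by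
  have hac := hf.on ha (ha.trans hab)
  rw [← hac.integral_deriv_eq_sub]
  have hc : ∫ _ in a..b, c = c * (b - a) := by simp [mul_comm]
  rw [← hc, intervalIntegral.integral_of_le hab, intervalIntegral.integral_of_le hab]
  refine setIntegral_mono_ae_restrict (by simp) hac.intervalIntegrable_deriv.1 ?_
  rw [EventuallyLE, ae_restrict_iff' measurableSet_Ioc]
  filter_upwards [h] with t ht hmem
  obtain ⟨D, hD, hle⟩ := ht hmem
  rwa [hD.deriv]

theorem LocAC.antitoneOn {f : ℝ → ℝ} (hf : LocAC f)
    (h : ∀ᵐ t : ℝ, 0 < t → ∃ D, HasDerivAt f D t ∧ D ≤ 0) : AntitoneOn f (Ici 0) := by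
  intro a ha b _ hab
  have := mul_sub_le_sub_of_ae_le_deriv hf.neg (c := 0) ha hab (by
    filter_upwards [h] with t ht hmem
    obtain ⟨D, hD, hle⟩ := ht (lt_of_le_of_lt ha hmem.1)
    exact ⟨-D, hD.neg, by linarith⟩)
  linarith

theorem LocAC.lipschitzOn {f : ℝ → ℝ} (hf : LocAC f) {C : ℝ}
    (h : ∀ᵐ t : ℝ, 0 < t → ∃ D, HasDerivAt f D t ∧ |D| ≤ C) :
    ∀ a, 0 ≤ a → ∀ b, 0 ≤ b → |f a - f b| ≤ C * |a - b| := by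
  have key : ∀ a b, 0 ≤ a → a ≤ b → |f a - f b| ≤ C * |a - b| := by
    intro a b ha hab
    have h1 := mul_sub_le_sub_of_ae_le_deriv hf (c := -C) ha hab (by
      filter_upwards [h] with t ht hmem
      obtain ⟨D, hD, hle⟩ := ht (lt_of_le_of_lt ha hmem.1)
      exact ⟨D, hD, (abs_le.1 hle).1⟩)
    have h2 := mul_sub_le_sub_of_ae_le_deriv hf.neg (c := -C) ha hab (by
      filter_upwards [h] with t ht hmem
      obtain ⟨D, hD, hle⟩ := ht (lt_of_le_of_lt ha hmem.1)
      exact ⟨-D, hD.neg, neg_le_neg (abs_le.1 hle).2⟩)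
    rw [abs_of_nonpos (sub_nonpos.2 hab), abs_le]
    constructor <;> linarith
  intro a ha b hb
  rcases le_total a b with hab | hab
  · exact key a b ha hab
  · rw [abs_sub_comm (f a), abs_sub_comm a]
    exact key b a hb hab

/-- A one-sided Barbalat lemma: where `F` exceeds `ε`, uniform continuity keeps it above `ε / 2`
on a time window of fixed length, over which `f` gains a fixed amount. -/
theorem eventually_le_of_tendsto {f F : ℝ → ℝ} (hf : LocAC f) {L : ℝ}
    (hL : Tendsto f atTop (𝓝 L)) (hF : UniformContinuousOn F (Ici 0))
    (h : ∀ᵐ t : ℝ, 0 < t → ∃ D, HasDerivAt f D t ∧ F t ≤ D) {ε : ℝ} (hε : 0 < ε) :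
    ∀ᶠ t in atTop, F t ≤ ε := by
  obtain ⟨δ, hδ, hδF⟩ := Metric.uniformContinuousOn_iff_le.1 hF (ε / 2) (by linarith)
  have hdiff : Tendsto (fun t => f (t + δ) - f t) atTop (𝓝 0) := by
    simpa using (hL.comp (tendsto_atTop_add_const_right atTop δ tendsto_id)).sub hL
  filter_upwards [hdiff.eventually_lt_const (show 0 < ε / 2 * δ by positivity),
    eventually_ge_atTop 0] with t ht ht0
  by_contra! hlt
  have := mul_sub_le_sub_of_ae_le_deriv hf (c := ε / 2) ht0 (b := t + δ) (by linarith) (by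
    filter_upwards [h] with u hu hmem
    obtain ⟨D, hD, hle⟩ := hu (lt_of_le_of_lt ht0 hmem.1)
    refine ⟨D, hD, le_trans ?_ hle⟩
    have h1 := hδF u (ht0.trans hmem.1.le) t ht0 (by
      rw [Real.dist_eq, abs_of_nonneg (by linarith [hmem.1])]
      linarith [hmem.2])
    rw [Real.dist_eq, abs_le] at h1
    linarith [h1.1])
  have h2 : ε / 2 * (t + δ - t) = ε / 2 * δ := by ring
  linarith

theorem tendsto_zero_of_hasDerivAt {f F : ℝ → ℝ} (hf : LocAC f) {L : ℝ}
    (hL : Tendsto f atTop (𝓝 L)) (hF : UniformContinuousOn F (Ici 0))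
    (h : ∀ᵐ t : ℝ, 0 < t → HasDerivAt f (F t) t) : Tendsto F atTop (𝓝 0) := by
  rw [Metric.tendsto_nhds]
  intro ε hε
  have h1 := eventually_le_of_tendsto hf hL hF
    (by filter_upwards [h] with t ht ht0 using ⟨_, ht ht0, le_rfl⟩) (half_pos hε)
  have h2 := eventually_le_of_tendsto hf.neg hL.neg
    (uniformContinuous_neg.comp_uniformContinuousOn hF)
    (by filter_upwards [h] with t ht ht0 using ⟨_, (ht ht0).neg, le_rfl⟩) (half_pos hε)
  filter_upwards [h1, h2] with t h1 h2
  rw [Real.dist_eq, sub_zero, abs_lt]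
  simp only [Function.comp_apply] at h2
  constructor <;> linarith

/-- If `V` is bounded below and decays at rate at least `F ≥ 0`, then `F` tends to zero. -/
theorem tendsto_zero_of_deriv_le_neg {V F : ℝ → ℝ} (hV : LocAC V) (hV0 : ∀ t, 0 ≤ V t)
    (hF : UniformContinuousOn F (Ici 0)) (hF0 : ∀ t, 0 ≤ t → 0 ≤ F t)
    (h : ∀ᵐ t : ℝ, 0 < t → ∃ D, HasDerivAt V D t ∧ D ≤ -F t) : Tendsto F atTop (𝓝 0) := by
  have hanti : AntitoneOn V (Ici 0) := hV.antitoneOn (by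
    filter_upwards [h] with t ht ht0
    obtain ⟨D, hD, hle⟩ := ht ht0
    exact ⟨D, hD, by linarith [hF0 t ht0.le]⟩)
  -- `V` is only known to be antitone on `[0, ∞)`, so it is frozen for negative times.
  have hlim : Tendsto (fun t => V (max t 0)) atTop (𝓝 (⨅ t, V (max t 0))) :=
    tendsto_atTop_ciInf
      (fun a b hab => hanti (le_max_right a 0) (le_max_right b 0) (max_le_max_right 0 hab))
      ⟨0, by rintro _ ⟨t, rfl⟩; exact hV0 _⟩
  have hlim' : Tendsto V atTop (𝓝 (⨅ t, V (max t 0))) := by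
    refine hlim.congr' ?_
    filter_upwards [eventually_ge_atTop 0] with t ht
    rw [max_eq_left ht]
  rw [Metric.tendsto_nhds]
  intro ε hε
  have h1 := eventually_le_of_tendsto hV.neg hlim'.neg hF (by
    filter_upwards [h] with t ht ht0
    obtain ⟨D, hD, hle⟩ := ht ht0
    exact ⟨-D, hD.neg, by linarith⟩) (half_pos hε)
  filter_upwards [h1, eventually_ge_atTop 0] with t h1 ht
  rw [Real.dist_eq, sub_zero, abs_of_nonneg (hF0 t ht)]
  linarith

/-- A nonincreasing function that comes near `0` infinitely often tends to `0`. -/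
theorem tendsto_zero_of_antitoneOn_of_mapClusterPt {V : ℝ → ℝ} (hV : AntitoneOn V (Ici 0))
    (hV0 : ∀ t, 0 ≤ V t) (h : MapClusterPt 0 atTop V) : Tendsto V atTop (𝓝 0) := by
  rw [Metric.tendsto_nhds]
  intro ε hε
  obtain ⟨s, hs, hs0⟩ := ((h.frequently (Iio_mem_nhds hε)).and_eventually
    (eventually_ge_atTop 0)).exists
  filter_upwards [eventually_ge_atTop s] with t ht
  rw [Real.dist_eq, sub_zero, abs_of_nonneg (hV0 t)]
  exact lt_of_le_of_lt (hV hs0 (hs0.trans ht : (0 : ℝ) ≤ t) ht) hs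

/-! ### Convexity and saddle monotonicity -/

section Convex

variable {E : Type*} [NormedAddCommGroup E] [InnerProductSpace ℝ E] [CompleteSpace E]

/-- The tangent inequality of a differentiable convex function. -/
theorem inner_gradient_le_sub {f : E → ℝ} (hf : ConvexOn ℝ univ f) {x : E}
    (hd : DifferentiableAt ℝ f x) (y : E) : inner ℝ (∇ f x) (y - x) ≤ f y - f x := by
  rw [inner_gradient_left]
  set φ : ℝ → ℝ := fun t => f (AffineMap.lineMap x y t) with hφ
  have hconv : ConvexOn ℝ univ φ := hf.comp_affineMap (AffineMap.lineMap x y)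
  have hderiv : HasDerivAt φ (fderiv ℝ f x (y - x)) 0 := by
    have h1 : HasFDerivAt f (fderiv ℝ f x) (AffineMap.lineMap x y (0 : ℝ)) := by
      simpa using hd.hasFDerivAt
    exact h1.comp_hasDerivAt (0 : ℝ) AffineMap.hasDerivAt_lineMap
  have := hconv.le_slope_of_hasDerivAt (mem_univ 0) (mem_univ 1) one_pos hderiv
  simpa [slope_def_field, hφ] using this

theorem inner_gradient_sub_nonneg {f : E → ℝ} (hf : ConvexOn ℝ univ f)
    (hd : Differentiable ℝ f) (x y : E) : 0 ≤ inner ℝ (∇ f x - ∇ f y) (x - y) := by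
  have h1 := inner_gradient_le_sub hf (hd x) y
  have h2 := inner_gradient_le_sub hf (hd y) x
  rw [← neg_sub x y, inner_neg_right] at h1
  rw [inner_sub_left]
  linarith

theorem eq_of_inner_gradient_sub_eq_zero {f : E → ℝ} (hf : StrictConvexOn ℝ univ f)
    (hd : Differentiable ℝ f) {x y : E} (h : inner ℝ (∇ f x - ∇ f y) (x - y) = 0) : x = y := by
  by_contra hne
  have hm := hf.2 (mem_univ x) (mem_univ y) hne one_half_pos one_half_pos (by norm_num)
  set w : E := (1 / 2 : ℝ) • x + (1 / 2 : ℝ) • y with hw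
  have h1 := inner_gradient_le_sub hf.convexOn (hd x) w
  have h2 := inner_gradient_le_sub hf.convexOn (hd y) w
  have e1 : w - x = -((1 / 2 : ℝ) • (x - y)) := by rw [hw]; module
  have e2 : w - y = (1 / 2 : ℝ) • (x - y) := by rw [hw]; module
  rw [e1, inner_neg_right, inner_smul_right] at h1
  rw [e2, inner_smul_right] at h2
  rw [inner_sub_left] at h
  simp only [smul_eq_mul] at hm
  linarith

end Convex

namespace Program

variable {n m r : ℕ} (P : Program n m r)

theorem inner_transpose_toEuclideanLin (mu : EuclideanSpace ℝ (Fin r))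
    (x : EuclideanSpace ℝ (Fin n)) :
    inner ℝ (P.A.transpose.toEuclideanLin mu) x = inner ℝ mu (P.A.toEuclideanLin x) := by
  rw [← Matrix.conjTranspose_eq_transpose_of_trivial, Matrix.toEuclideanLin_conjTranspose_eq_adjoint,
    LinearMap.adjoint_inner_left]

variable {P}

/-- The map `(x, μ, λ) ↦ (-v, -h, -g)` is monotone on `λ ≥ 0`: it is the operator of the
convex-concave Lagrangian. The monotonicity of `∇f` is kept as a separate term. -/
theorem saddle_monotone (hP : P.Assumption) (x x' : EuclideanSpace ℝ (Fin n))
    (mu mu' : EuclideanSpace ℝ (Fin r)) {lam lam' : EuclideanSpace ℝ (Fin m)}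
    (hl : ∀ l, 0 ≤ lam l) (hl' : ∀ l, 0 ≤ lam' l) :
    inner ℝ (P.v x mu lam - P.v x' mu' lam') (x - x') + inner ℝ (P.h x - P.h x') (mu - mu')
      + ∑ l, (lam l - lam' l) * (P.g l x - P.g l x')
      ≤ -inner ℝ (∇ P.f x - ∇ P.f x') (x - x') := by
  have hh : P.h x - P.h x' = P.A.toEuclideanLin (x - x') := by
    simp [Program.h]
  have hv : P.v x mu lam - P.v x' mu' lam' = -(∇ P.f x - ∇ P.f x')
      - (∑ l, (lam l • ∇ (P.g l) x - lam' l • ∇ (P.g l) x'))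
      - P.A.transpose.toEuclideanLin (mu - mu') := by
    simp only [Program.v, Finset.sum_sub_distrib, map_sub]
    abel
  have hg : ∑ l, (lam l - lam' l) * (P.g l x - P.g l x')
      ≤ ∑ l, inner ℝ (lam l • ∇ (P.g l) x - lam' l • ∇ (P.g l) x') (x - x') := by
    refine Finset.sum_le_sum fun l _ => ?_
    have hd := (hP.contDiff_g l).differentiable one_ne_zero
    have h1 := inner_gradient_le_sub (hP.convex_g l) (hd x) x'
    have h2 := inner_gradient_le_sub (hP.convex_g l) (hd x') x
    rw [← neg_sub x x', inner_neg_right] at h1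
    rw [inner_sub_left, inner_smul_left, inner_smul_left]
    simp only [conj_trivial]
    nlinarith [mul_le_mul_of_nonneg_left h1 (hl l), mul_le_mul_of_nonneg_left h2 (hl' l)]
  rw [hv, hh, inner_sub_left, inner_sub_left, inner_neg_left, inner_transpose_toEuclideanLin,
    sum_inner, real_inner_comm (mu - mu')]
  linarith

theorem continuous_v (hP : P.Assumption) :
    Continuous fun p : EuclideanSpace ℝ (Fin n) × EuclideanSpace ℝ (Fin r) ×
      EuclideanSpace ℝ (Fin m) => P.v p.1 p.2.1 p.2.2 := by
  have h1 := hP.lipschitz_f.continuous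
  have h2 := fun l => (hP.lipschitz_g l).continuous
  have h3 := P.A.transpose.toEuclideanLin.continuous_of_finiteDimensional
  unfold Program.v
  fun_prop

theorem continuous_h : Continuous P.h := by
  have h3 := P.A.toEuclideanLin.continuous_of_finiteDimensional
  unfold Program.h
  fun_prop

end Program

/-! ### Storage function of a family of blocks -/

section Storage

variable {ι : Type*}

/-- The joint state of a family of blocks. -/
abbrev State (B : ι → Block) : Type _ := ∀ i, Fin ((B i).lags + 1) → ℝ

variable (B : ι → Block)

/-- The equilibrium state with output `y`, reached for zero input: the integrators carry `y`
and the lags vanish. -/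
def equilibrium (y : ι → ℝ) : State B := fun i => Pi.single 0 (y i)

/-- `z` is driven by the inputs `u`, the coordinates of the blocks in `pos` being subject to a
projection onto `[0, ∞)`. The velocity field `F` of a projected coordinate is described by the
two properties of `proj` that matter: it is no larger than the unprojected one, and it points no
less towards every admissible `e`. -/
def Driven (pos : Set ι) (u : ι → ℝ → ℝ) (z : ℝ → State B) : Prop :=
  ∀ i k, ∃ F : ℝ → ℝ, Caratheodory (fun t => z t i k) F ∧
    ∀ t, 0 < t → |F t| ≤ |-(B i).a k * z t i k + (B i).c k * u i t| ∧
      ∀ e : ℝ, (i ∈ pos → 0 ≤ e) →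
        (z t i k - e) * F t ≤ (z t i k - e) * (-(B i).a k * z t i k + (B i).c k * u i t)

variable {B}

theorem abs_sub_le_of_driven {pos : Set ι} {u : ι → ℝ → ℝ} {z : ℝ → State B}
    (hz : Driven B pos u z) (i : ι) (k : Fin ((B i).lags + 1)) {C : ℝ}
    (hC : ∀ t, 0 ≤ t → |-(B i).a k * z t i k + (B i).c k * u i t| ≤ C) :
    ∀ s, 0 ≤ s → ∀ t, 0 ≤ t → |z s i k - z t i k| ≤ C * |s - t| := by
  obtain ⟨F, hF, hF'⟩ := hz i k
  refine LocAC.lipschitzOn hF.1 ?_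
  filter_upwards [hF.2] with t ht ht0
  exact ⟨F t, ht ht0, (hF' t ht0).1.trans (hC t ht0.le)⟩

variable [Fintype ι]

variable (B) in
/-- Half the squared distance of `z` to `e`, each coordinate being weighted by the inverse of its
gain. -/
noncomputable def storage (e z : State B) : ℝ :=
  ∑ i, ∑ k, (z i k - e i k) ^ 2 / (2 * (B i).c k)

theorem storage_nonneg (e z : State B) : 0 ≤ storage B e z :=
  Finset.sum_nonneg fun i _ => Finset.sum_nonneg fun k _ =>
    div_nonneg (sq_nonneg _) (mul_nonneg zero_le_two ((B i).c_pos k).le)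

theorem storage_self (e : State B) : storage B e e = 0 := by simp [storage]

theorem continuous_storage (e : State B) : Continuous (storage B e) := by
  unfold storage
  fun_prop

theorem sq_sub_le_storage (e z : State B) (i : ι) (k : Fin ((B i).lags + 1)) :
    (z i k - e i k) ^ 2 ≤ 2 * (B i).c k * storage B e z := by
  have hc := (B i).c_pos
  have h0 : ∀ j l, 0 ≤ (z j l - e j l) ^ 2 / (2 * (B j).c l) := fun j l =>
    div_nonneg (sq_nonneg _) (mul_nonneg zero_le_two ((B j).c_pos l).le)
  have h1 : (z i k - e i k) ^ 2 / (2 * (B i).c k) ≤ storage B e z :=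
    (Finset.single_le_sum (fun l _ => h0 i l) (Finset.mem_univ k)).trans
      (Finset.single_le_sum (f := fun j => ∑ l, (z j l - e j l) ^ 2 / (2 * (B j).c l))
        (fun j _ => Finset.sum_nonneg fun l _ => h0 j l) (Finset.mem_univ i))
  rwa [div_le_iff₀' (mul_pos two_pos (hc k))] at h1

theorem isBounded_storage_le (e : State B) (C : ℝ) :
    Bornology.IsBounded {z | storage B e z ≤ C} := by
  simp only [← Bornology.forall_isBounded_image_eval_iff]
  refine fun i k => (Metric.isBounded_closedBall (x := e i k)
    (r := 2 * (B i).c k * C + 1)).subset ?_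
  rintro _ ⟨_, ⟨z, hz, rfl⟩, rfl⟩
  have h1 := sq_sub_le_storage e z i k
  have h2 := mul_le_mul_of_nonneg_left hz (mul_pos two_pos ((B i).c_pos k)).le
  rw [Metric.mem_closedBall, Real.dist_eq, Function.eval, Function.eval]
  nlinarith [sq_nonneg (|z i k - e i k| - 1), sq_abs (z i k - e i k), abs_nonneg (z i k - e i k)]

theorem tendsto_of_storage_tendsto_zero {α : Type*} {l : Filter α} {e : State B} {z : α → State B}
    (h : Tendsto (fun t => storage B e (z t)) l (𝓝 0)) : Tendsto z l (𝓝 e) := by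
  rw [tendsto_pi_nhds]
  intro i
  rw [tendsto_pi_nhds]
  intro k
  have h1 : Tendsto (fun t => (z t i k - e i k) ^ 2) l (𝓝 0) :=
    squeeze_zero (fun t => sq_nonneg _) (fun t => sq_sub_le_storage e (z t) i k)
      (by simpa using h.const_mul (2 * (B i).c k))
  have h2 : Tendsto (fun t => z t i k - e i k) l (𝓝 0) := by
    rw [tendsto_zero_iff_abs_tendsto_zero]
    simpa [Real.sqrt_sq_eq_abs, Function.comp_def] using h1.sqrt
  simpa using h2.add_const (e i k)

theorem locAC_storage {pos : Set ι} {u : ι → ℝ → ℝ} {z : ℝ → State B} (hz : Driven B pos u z)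
    (e : State B) : LocAC fun t => storage B e (z t) := by
  refine LocAC.sum _ fun i _ => LocAC.sum _ fun k _ => ?_
  obtain ⟨F, hF, -⟩ := hz i k
  have h1 : LocAC fun t => z t i k + -e i k := LocAC.add hF.1 (locAC_const _)
  simpa only [sub_eq_add_neg, sq, div_eq_mul_inv] using
    (h1.mul h1).mul (locAC_const (2 * (B i).c k)⁻¹)

/-- The dissipation inequality: the storage function grows at most at the rate at which the inputs
supply power, less the power lost in the lags. -/
theorem storage_deriv_le {pos : Set ι} {u : ι → ℝ → ℝ} {z : ℝ → State B} (hz : Driven B pos u z)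
    {y : ι → ℝ} (hy : ∀ i ∈ pos, 0 ≤ y i) :
    ∀ᵐ t : ℝ, 0 < t → ∃ D, HasDerivAt (fun s => storage B (equilibrium B y) (z s)) D t ∧
      D ≤ ∑ i, (((∑ k, z t i k) - y i) * u i t
        - ∑ k, (B i).a k / (B i).c k * z t i k ^ 2) := by
  choose F hF hF' using hz
  have hae : ∀ᵐ t : ℝ, ∀ i k, 0 < t → HasDerivAt (fun s => z s i k) (F i k t) t :=
    ae_all_iff.2 fun i => ae_all_iff.2 fun k => (hF i k).2
  filter_upwards [hae] with t ht ht0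
  set e := equilibrium B y with he
  refine ⟨∑ i, ∑ k, (z t i k - e i k) * F i k t / (B i).c k, ?_, ?_⟩
  · refine HasDerivAt.fun_sum fun i _ => HasDerivAt.fun_sum fun k _ => ?_
    have h1 := ((((ht i k ht0).sub_const (e i k)).pow 2).div_const (2 * (B i).c k))
    have hc := ((B i).c_pos k).ne'
    refine HasDerivAt.congr_deriv h1 ?_
    rw [div_eq_div_iff (mul_ne_zero two_ne_zero hc) hc]
    push_cast
    ring
  · refine Finset.sum_le_sum fun i _ => ?_
    have hy0 : ∑ k, e i k = y i := by simp [he, equilibrium]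
    rw [← hy0, ← Finset.sum_sub_distrib, Finset.sum_mul, ← Finset.sum_sub_distrib]
    refine Finset.sum_le_sum fun k _ => ?_
    have hc := (B i).c_pos k
    have hae0 : (B i).a k * e i k = 0 := by
      rcases eq_or_ne k 0 with rfl | hk
      · simp [(B i).a_zero]
      · simp [he, equilibrium, hk]
    have h1 := ((hF' i k t ht0).2 (e i k) (fun hi => by
      rcases eq_or_ne k 0 with rfl | hk
      · simpa [he, equilibrium] using hy i hi
      · simp [he, equilibrium, hk]))
    rw [div_le_iff₀ hc]
    refine h1.trans (le_of_eq ?_)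
    field_simp
    linear_combination z t i k * hae0

end Storage

/-! ### The closed loop -/

section ClosedLoop

variable {n m r : ℕ}

/-- All blocks of the dynamics as one family: those of the primal variables, of the multipliers of
the equality constraints, and of the multipliers of the inequality constraints. -/
def allBlocks (M : Fin n → Block) (H : Fin r → Block) (G : Fin m → Block) :
    Fin n ⊕ Fin r ⊕ Fin m → Block :=
  Sum.elim M (Sum.elim H G)

/-- The signals that determine all others: the primal output `x` and the joint state. Because of
the feedthrough terms, the state determines `x` only through an implicit equation. -/
abbrev Config (M : Fin n → Block) (H : Fin r → Block) (G : Fin m → Block) : Type :=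
  EuclideanSpace ℝ (Fin n) × State (allBlocks M H G)

variable (P : Program n m r) {M : Fin n → Block} {H : Fin r → Block} {G : Fin m → Block}

/-- The multiplier `μ` of the equality constraints. -/
noncomputable def muOut (q : Config M H G) : EuclideanSpace ℝ (Fin r) :=
  WithLp.toLp 2 fun j => ∑ k, q.2 (.inr (.inl j)) k + (H j).d * P.h q.1 j

/-- The multiplier `λ` of the inequality constraints. -/
noncomputable def lamOut (q : Config M H G) : EuclideanSpace ℝ (Fin m) :=
  WithLp.toLp 2 fun l => ∑ k, q.2 (.inr (.inr l)) k + (G l).d * max 0 (P.g l q.1)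

/-- The input `v` of the primal blocks. -/
noncomputable def vOut (q : Config M H G) : EuclideanSpace ℝ (Fin n) :=
  P.v q.1 (muOut P q) (lamOut P q)

/-- The inputs of all blocks. -/
noncomputable def inputs (q : Config M H G) : Fin n ⊕ Fin r ⊕ Fin m → ℝ :=
  Sum.elim (vOut P q) (Sum.elim (P.h q.1) fun l => P.g l q.1)

/-- The configurations that satisfy the output equation of `x` and the sign constraint. -/
def consistent : Set (Config M H G) :=
  {q | (∀ i, q.1 i = ∑ k, q.2 (.inl i) k + (M i).d * vOut P q i) ∧
    ∀ l k, 0 ≤ q.2 (.inr (.inr l)) k}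

variable {P}

theorem continuous_muOut : Continuous (muOut P : Config M H G → _) := by
  have h := Program.continuous_h (P := P)
  unfold muOut
  fun_prop

theorem continuous_lamOut (hP : P.Assumption) : Continuous (lamOut P : Config M H G → _) := by
  have h := fun l => (hP.contDiff_g l).continuous
  unfold lamOut
  fun_prop

theorem continuous_vOut (hP : P.Assumption) : Continuous (vOut P : Config M H G → _) := by
  have h : Continuous fun q : Config M H G => (q.1, muOut P q, lamOut P q) :=
    continuous_fst.prodMk (continuous_muOut.prodMk (continuous_lamOut hP))
  have hcomp := (Program.continuous_v hP).comp h
  unfold vOut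
  exact hcomp

theorem continuous_inputs (hP : P.Assumption) (i : Fin n ⊕ Fin r ⊕ Fin m) :
    Continuous fun q : Config M H G => inputs P q i := by
  have hv := continuous_vOut (M := M) (H := H) (G := G) hP
  have hh := Program.continuous_h (P := P)
  have hg := fun l => (hP.contDiff_g l).continuous
  rcases i with i | j | l
  · change Continuous fun q : Config M H G => vOut P q i
    fun_prop
  · change Continuous fun q : Config M H G => P.h q.1 j
    fun_prop
  · exact (hg l).comp continuous_fst

theorem isClosed_consistent (hP : P.Assumption) :
    IsClosed (consistent P : Set (Config M H G)) := by
  have hv := continuous_vOut (M := M) (H := H) (G := G) hP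
  simp only [consistent, ofPred_and, ofPred_forall]
  refine (isClosed_iInter fun i => isClosed_eq (by fun_prop) (by fun_prop)).inter
    (isClosed_iInter fun l => isClosed_iInter fun k => isClosed_le (by fun_prop) (by fun_prop))

theorem lamOut_nonneg {q : Config M H G} (hq : q ∈ consistent P) (l : Fin m) :
    0 ≤ lamOut P q l :=
  add_nonneg (Finset.sum_nonneg fun k _ => hq.2 l k)
    (mul_nonneg (G l).d_nonneg (le_max_left _ _))

/-! ### The primal output as a function of the state -/

/-- The output that `q` would have if the state were `z` and the feedthrough were the one of `q`. -/
noncomputable def shiftOut (q : Config M H G) (z : State (allBlocks M H G)) :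
    EuclideanSpace ℝ (Fin n) :=
  q.1 + WithLp.toLp 2 fun i => ∑ k, z (.inl i) k - ∑ k, q.2 (.inl i) k

variable (P) in
/-- How far the `i`-th primal output can move when the state moves from `q.2` to `z`. -/
noncomputable def modulus (i : Fin n) (p : Config M H G × State (allBlocks M H G)) : ℝ :=
  |∑ k, p.2 (.inl i) k - ∑ k, p.1.2 (.inl i) k| +
    √((M i).d * ∑ j, (M j).d * (vOut P (shiftOut p.1 p.2, p.2) j - vOut P p.1 j) ^ 2)

theorem continuous_modulus (hP : P.Assumption) (i : Fin n) :
    Continuous (modulus P i : Config M H G × State (allBlocks M H G) → ℝ) := by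
  have hv := continuous_vOut (M := M) (H := H) (G := G) hP
  unfold modulus shiftOut
  fun_prop

theorem modulus_self (i : Fin n) (q : Config M H G) : modulus P i (q, q.2) = 0 := by
  have : shiftOut q q.2 = q.1 := by
    simp [shiftOut, ← Pi.zero_def]
  simp [modulus, this]

/-- For a fixed state, `-v` is monotone in `x`: the feedthrough of `h` into `μ` and that of
`max 0 (g l)` into `λ` are gradients of convex penalties. -/
theorem inner_vOut_sub_nonpos (hP : P.Assumption) {q : Config M H G} (hq : q ∈ consistent P)
    (y : EuclideanSpace ℝ (Fin n)) :
    inner ℝ (vOut P q - vOut P (y, q.2)) (q.1 - y) ≤ 0 := by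
  have h1 := Program.saddle_monotone hP q.1 y (muOut P q) (muOut P (y, q.2))
    (lamOut_nonneg hq)
    (lam' := lamOut P (y, q.2)) (fun l => add_nonneg (Finset.sum_nonneg fun k _ => hq.2 l k)
      (mul_nonneg (G l).d_nonneg (le_max_left _ _)))
  have h2 := inner_gradient_sub_nonneg hP.convex_f
    (hP.contDiff_f.differentiable one_ne_zero) q.1 y
  have h3 : 0 ≤ inner ℝ (P.h q.1 - P.h y) (muOut P q - muOut P (y, q.2)) := by
    rw [PiLp.inner_apply]
    refine Finset.sum_nonneg fun j _ => ?_
    simp only [muOut, PiLp.sub_apply, RCLike.inner_apply, conj_trivial]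
    nlinarith [mul_nonneg (H j).d_nonneg (sq_nonneg (P.h q.1 j - P.h y j))]
  have h4 : 0 ≤ ∑ l, (lamOut P q l - lamOut P (y, q.2) l) * (P.g l q.1 - P.g l y) := by
    refine Finset.sum_nonneg fun l _ => ?_
    have e : lamOut P q l - lamOut P (y, q.2) l
        = (G l).d * (max 0 (P.g l q.1) - max 0 (P.g l y)) := by
      simp only [lamOut]
      ring
    rw [e, mul_assoc]
    refine mul_nonneg (G l).d_nonneg ?_
    rcases le_total (P.g l q.1) (P.g l y) with h | h
    · exact mul_nonneg_of_nonpos_of_nonpos (sub_nonpos.2 (max_le_max_left 0 h)) (sub_nonpos.2 h)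
    · exact mul_nonneg (sub_nonneg.2 (max_le_max_left 0 h)) (sub_nonneg.2 h)
  change inner ℝ (vOut P q - vOut P (y, q.2)) (q.1 - y) + _ + _ ≤ _ at h1
  linarith

/-- Since `-v` is monotone in `x` for a fixed state, the equation `x = ∑ ξ + D v` determines `x`
continuously from the state. -/
theorem abs_sub_le_modulus (hP : P.Assumption) {q q' : Config M H G} (hq : q ∈ consistent P)
    (hq' : q' ∈ consistent P) (i : Fin n) : |q.1 i - q'.1 i| ≤ modulus P i (q', q.2) := by
  set y := shiftOut q' q.2 with hy
  have hdiff : ∀ j, q.1 j - y j = (M j).d * (vOut P q j - vOut P q' j) := by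
    intro j
    simp only [hy, shiftOut, PiLp.add_apply]
    linear_combination hq.1 j - hq'.1 j
  have hmono := inner_vOut_sub_nonpos hP hq y
  -- Termwise, `s ^ 2 - w ^ 2 ≤ 2 * s * (s - w)`, and `hmono` bounds the weighted sum of the latter.
  have hsum : ∑ j, (M j).d * (vOut P q j - vOut P q' j) ^ 2
      ≤ ∑ j, (M j).d * (vOut P (y, q.2) j - vOut P q' j) ^ 2 := by
    rw [PiLp.inner_apply] at hmono
    rw [← sub_nonpos, ← Finset.sum_sub_distrib]
    refine le_trans (Finset.sum_le_sum (g := fun j =>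
      2 * inner ℝ ((vOut P q - vOut P (y, q.2)) j) ((q.1 - y) j)) fun j _ => ?_) ?_
    · simp only [PiLp.sub_apply, RCLike.inner_apply, conj_trivial]
      rw [hdiff]
      nlinarith [mul_nonneg (M j).d_nonneg (sq_nonneg (vOut P q j - vOut P (y, q.2) j))]
    · rw [← Finset.mul_sum]
      linarith
  have hi : (M i).d * (vOut P q i - vOut P q' i) ^ 2
      ≤ ∑ j, (M j).d * (vOut P q j - vOut P q' j) ^ 2 :=
    Finset.single_le_sum (f := fun j => (M j).d * (vOut P q j - vOut P q' j) ^ 2)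
      (fun j _ => mul_nonneg (M j).d_nonneg (sq_nonneg _)) (Finset.mem_univ i)
  have hsqrt : |(M i).d * (vOut P q i - vOut P q' i)|
      ≤ √((M i).d * ∑ j, (M j).d * (vOut P (y, q.2) j - vOut P q' j) ^ 2) := by
    refine Real.abs_le_sqrt ?_
    calc ((M i).d * (vOut P q i - vOut P q' i)) ^ 2
        = (M i).d * ((M i).d * (vOut P q i - vOut P q' i) ^ 2) := by ring
      _ ≤ _ := mul_le_mul_of_nonneg_left (hi.trans hsum) (M i).d_nonneg
  have e : q.1 i - q'.1 i = (∑ k, q.2 (.inl i) k - ∑ k, q'.2 (.inl i) k)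
      + (M i).d * (vOut P q i - vOut P q' i) := by
    linear_combination hq.1 i - hq'.1 i
  rw [e]
  exact (abs_add_le _ _).trans (add_le_add le_rfl hsqrt)

/-! ### Dissipation relative to a KKT triple -/

variable (P) in
/-- A lower bound for the decay rate of the storage function. -/
noncomputable def dissipation (p : EuclideanSpace ℝ (Fin n) × EuclideanSpace ℝ (Fin r) ×
    EuclideanSpace ℝ (Fin m)) (q : Config M H G) : ℝ :=
  (∑ i, ∑ k, (allBlocks M H G i).a k / (allBlocks M H G i).c k * q.2 i k ^ 2)
    + ∑ i, (M i).d * vOut P q i ^ 2 + inner ℝ (∇ P.f q.1 - ∇ P.f p.1) (q.1 - p.1)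
    + ∑ l, lamOut P q l * -P.g l p.1

/-- The outputs of all blocks at a triple `(x, μ, λ)`. -/
def outputs (p : EuclideanSpace ℝ (Fin n) × EuclideanSpace ℝ (Fin r) × EuclideanSpace ℝ (Fin m)) :
    Fin n ⊕ Fin r ⊕ Fin m → ℝ :=
  Sum.elim p.1 (Sum.elim p.2.1 p.2.2)

theorem Block.a_nonneg (B : Block) (k : Fin (B.lags + 1)) : 0 ≤ B.a k := by
  rw [← B.a_zero]
  exact B.a_strictMono.monotone (Fin.zero_le k)

theorem Block.a_pos (B : Block) {k : Fin (B.lags + 1)} (hk : k ≠ 0) : 0 < B.a k := by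
  rw [← B.a_zero]
  exact B.a_strictMono (Fin.pos_iff_ne_zero.2 hk)

theorem continuous_dissipation (hP : P.Assumption) (p : EuclideanSpace ℝ (Fin n) ×
    EuclideanSpace ℝ (Fin r) × EuclideanSpace ℝ (Fin m)) :
    Continuous (dissipation P p : Config M H G → ℝ) := by
  have h1 := continuous_vOut (M := M) (H := H) (G := G) hP
  have h2 := continuous_lamOut (M := M) (H := H) (G := G) hP
  have h3 := hP.lipschitz_f.continuous
  have h4 := fun l => (hP.contDiff_g l).continuous
  unfold dissipation
  fun_prop

/-- The power supplied to the blocks by the interconnection: substituting the output equations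
turns it into the pairing of the saddle operator, less the losses in the feedthroughs. -/
theorem supply_le_neg_dissipation (hP : P.Assumption) {p : EuclideanSpace ℝ (Fin n) ×
    EuclideanSpace ℝ (Fin r) × EuclideanSpace ℝ (Fin m)} (hp : p ∈ P.kktSet)
    {q : Config M H G} (hq : q ∈ consistent P) :
    ∑ i, (((∑ k, q.2 i k) - outputs p i) * inputs P q i
      - ∑ k, (allBlocks M H G i).a k / (allBlocks M H G i).c k * q.2 i k ^ 2)
      ≤ -dissipation P p q := by
  obtain ⟨hstat, hfeas, hlam, hg, hcompl⟩ := hp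
  have hv0 : P.v p.1 p.2.1 p.2.2 = 0 := by
    rw [Program.v, ← neg_eq_zero, ← hstat]
    abel
  have hmono := Program.saddle_monotone hP q.1 p.1 (muOut P q) p.2.1 (lamOut_nonneg hq) hlam
  rw [hv0, show P.h p.1 = 0 from hfeas, sub_zero, sub_zero, PiLp.inner_apply, PiLp.inner_apply]
    at hmono
  rw [Finset.sum_sub_distrib, Fintype.sum_sum_type, Fintype.sum_sum_type, dissipation]
  have h1 : ∑ i, ((∑ k, q.2 (.inl i) k) - outputs p (.inl i)) * inputs P q (.inl i)
      = ∑ i, inner ℝ (vOut P q i) ((q.1 - p.1) i) - ∑ i, (M i).d * vOut P q i ^ 2 := by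
    rw [← Finset.sum_sub_distrib]
    refine Finset.sum_congr rfl fun i _ => ?_
    simp only [PiLp.sub_apply, RCLike.inner_apply, conj_trivial, outputs, inputs,
      Sum.elim_inl]
    linear_combination -vOut P q i * hq.1 i
  have h2 : ∑ j, ((∑ k, q.2 (.inr (.inl j)) k) - outputs p (.inr (.inl j)))
        * inputs P q (.inr (.inl j))
      ≤ ∑ j, inner ℝ (P.h q.1 j) ((muOut P q - p.2.1) j) := by
    refine Finset.sum_le_sum fun j _ => ?_
    simp only [PiLp.sub_apply, RCLike.inner_apply, conj_trivial, outputs, inputs, muOut,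
      Sum.elim_inl, Sum.elim_inr]
    nlinarith [mul_nonneg (H j).d_nonneg (sq_nonneg (P.h q.1 j))]
  have h3 : ∑ l, ((∑ k, q.2 (.inr (.inr l)) k) - outputs p (.inr (.inr l)))
        * inputs P q (.inr (.inr l)) + ∑ l, lamOut P q l * -P.g l p.1
      ≤ ∑ l, (lamOut P q l - p.2.2 l) * (P.g l q.1 - P.g l p.1) := by
    rw [← Finset.sum_add_distrib]
    refine Finset.sum_le_sum fun l _ => ?_
    have hmax : 0 ≤ max 0 (P.g l q.1) * P.g l q.1 := by
      rcases le_total 0 (P.g l q.1) with h | h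
      · exact mul_nonneg (le_max_left _ _) h
      · simp [max_eq_left h]
    have e : ∑ k, q.2 (.inr (.inr l)) k = lamOut P q l - (G l).d * max 0 (P.g l q.1) := by
      simp [lamOut]
    simp only [outputs, inputs, Sum.elim_inr]
    rw [e]
    nlinarith [mul_nonneg (G l).d_nonneg hmax, hcompl l]
  change ∑ i, inner ℝ (vOut P q i) ((q.1 - p.1) i) + _ + _ ≤ _ at hmono
  linarith

/-- The four terms of the dissipation are nonnegative, so each of them is bounded by it. -/
theorem dissipation_terms (hP : P.Assumption) {p : EuclideanSpace ℝ (Fin n) ×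
    EuclideanSpace ℝ (Fin r) × EuclideanSpace ℝ (Fin m)} (hp : p ∈ P.kktSet)
    {q : Config M H G} (hq : q ∈ consistent P) :
    (∀ i k, 0 ≤ (allBlocks M H G i).a k / (allBlocks M H G i).c k * q.2 i k ^ 2 ∧
      (allBlocks M H G i).a k / (allBlocks M H G i).c k * q.2 i k ^ 2 ≤ dissipation P p q) ∧
    (∀ i, 0 ≤ (M i).d * vOut P q i ^ 2 ∧ (M i).d * vOut P q i ^ 2 ≤ dissipation P p q) ∧
    (0 ≤ inner ℝ (∇ P.f q.1 - ∇ P.f p.1) (q.1 - p.1) ∧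
      inner ℝ (∇ P.f q.1 - ∇ P.f p.1) (q.1 - p.1) ≤ dissipation P p q) ∧
    (∀ l, 0 ≤ lamOut P q l * -P.g l p.1 ∧ lamOut P q l * -P.g l p.1 ≤ dissipation P p q) := by
  have h1 : ∀ i k, 0 ≤ (allBlocks M H G i).a k / (allBlocks M H G i).c k * q.2 i k ^ 2 :=
    fun i k => mul_nonneg (div_nonneg (Block.a_nonneg _ k) ((allBlocks M H G i).c_pos k).le)
      (sq_nonneg _)
  have h2 : ∀ i, 0 ≤ (M i).d * vOut P q i ^ 2 := fun i =>
    mul_nonneg (M i).d_nonneg (sq_nonneg _)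
  have h3 := inner_gradient_sub_nonneg hP.convex_f
    (hP.contDiff_f.differentiable one_ne_zero) q.1 p.1
  have h4 : ∀ l, 0 ≤ lamOut P q l * -P.g l p.1 := fun l =>
    mul_nonneg (lamOut_nonneg hq l) (neg_nonneg.2 (hp.2.2.2.1 l))
  have s1 := fun i => Finset.sum_nonneg fun k (_ : k ∈ Finset.univ) => h1 i k
  have t1 := Finset.sum_nonneg fun i (_ : i ∈ Finset.univ) => s1 i
  have t2 := Finset.sum_nonneg fun i (_ : i ∈ Finset.univ) => h2 i
  have t4 := Finset.sum_nonneg fun l (_ : l ∈ Finset.univ) => h4 l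
  unfold dissipation
  refine ⟨fun i k => ⟨h1 i k, ?_⟩, fun i => ⟨h2 i, ?_⟩, ⟨h3, by linarith⟩,
    fun l => ⟨h4 l, ?_⟩⟩
  · have a1 := Finset.single_le_sum (fun k _ => h1 i k) (Finset.mem_univ k)
    have a2 := Finset.single_le_sum (fun i _ => s1 i) (Finset.mem_univ i)
    linarith
  · have a1 := Finset.single_le_sum (fun i _ => h2 i) (Finset.mem_univ i)
    linarith
  · have a1 := Finset.single_le_sum (fun i _ => h4 i) (Finset.mem_univ l)
    linarith

end ClosedLoop

/-! ### Trajectories -/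

section Trajectory

variable {n m r : ℕ} {P : Program n m r} {M : Fin n → Block} {H : Fin r → Block}
  {G : Fin m → Block}

variable (P) in
/-- A trajectory, expressed through its configurations alone. -/
structure IsRun (q : ℝ → Config M H G) : Prop where
  driven : Driven (allBlocks M H G) (range (Sum.inr ∘ Sum.inr)) (fun i t => inputs P (q t) i)
    fun t => (q t).2
  consistent : ∀ t, 0 ≤ t → q t ∈ consistent P
  integrator : ∀ i, Caratheodory (fun t => (q t).2 (.inl i) 0) fun t => (M i).c 0 * vOut P (q t) i

/-- The configurations along a trajectory. -/
def configs (x : ℝ → EuclideanSpace ℝ (Fin n)) (ξ : ∀ i, ℝ → Fin ((M i).lags + 1) → ℝ)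
    (ζ : ∀ j, ℝ → Fin ((H j).lags + 1) → ℝ) (ρ : ∀ l, ℝ → Fin ((G l).lags + 1) → ℝ)
    (t : ℝ) : Config M H G :=
  (x t, fun
    | .inl i => ξ i t
    | .inr (.inl j) => ζ j t
    | .inr (.inr l) => ρ l t)

theorem abs_proj_le (ε σ : ℝ) : |proj ε σ| ≤ |σ| := by
  unfold proj
  split_ifs <;> simp

theorem sub_mul_proj_le {ε e : ℝ} (he : 0 ≤ e) (σ : ℝ) : (ε - e) * proj ε σ ≤ (ε - e) * σ := by
  unfold proj
  split_ifs with h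
  · rw [h.1, zero_sub, mul_zero, neg_mul]
    exact neg_nonneg.2 (mul_nonpos_of_nonneg_of_nonpos he h.2.le)
  · exact le_rfl

variable {x : ℝ → EuclideanSpace ℝ (Fin n)} {mu : ℝ → EuclideanSpace ℝ (Fin r)}
  {lam : ℝ → EuclideanSpace ℝ (Fin m)} {ξ : ∀ i, ℝ → Fin ((M i).lags + 1) → ℝ}
  {ζ : ∀ j, ℝ → Fin ((H j).lags + 1) → ℝ} {ρ : ∀ l, ℝ → Fin ((G l).lags + 1) → ℝ}

theorem IsTrajectory.mu_eq (h : IsTrajectory P M H G x mu lam ξ ζ ρ) {t : ℝ} (ht : 0 ≤ t) :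
    mu t = muOut P (configs x ξ ζ ρ t) := by
  ext j
  exact (h.dual_eq j).output t ht

theorem IsTrajectory.lam_eq (h : IsTrajectory P M H G x mu lam ξ ζ ρ) {t : ℝ} (ht : 0 ≤ t) :
    lam t = lamOut P (configs x ξ ζ ρ t) := by
  ext l
  exact (h.dual_ineq l).output t ht

theorem IsTrajectory.v_eq (h : IsTrajectory P M H G x mu lam ξ ζ ρ) {t : ℝ} (ht : 0 ≤ t) :
    P.v (x t) (mu t) (lam t) = vOut P (configs x ξ ζ ρ t) := by
  rw [h.mu_eq ht, h.lam_eq ht]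
  rfl

theorem IsTrajectory.isRun (h : IsTrajectory P M H G x mu lam ξ ζ ρ) :
    IsRun P (configs x ξ ζ ρ) where
  driven := by
    rintro (i | j | l) k
    · refine ⟨_, (h.primal i).state k, fun t ht => ?_⟩
      rw [h.v_eq ht.le]
      exact ⟨le_rfl, fun _ _ => le_rfl⟩
    · exact ⟨_, (h.dual_eq j).state k, fun t _ => ⟨le_rfl, fun _ _ => le_rfl⟩⟩
    · exact ⟨_, (h.dual_ineq l).state k, fun t _ => ⟨abs_proj_le _ _, fun e he =>
        sub_mul_proj_le (he ⟨l, rfl⟩) _⟩⟩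
  consistent t ht := by
    refine ⟨fun i => ?_, fun l k => (h.dual_ineq l).nonneg t ht k⟩
    rw [← h.v_eq ht]
    exact (h.primal i).output t ht
  integrator i := by
    refine ⟨((h.primal i).state 0).1, ?_⟩
    filter_upwards [((h.primal i).state 0).2] with t ht ht0
    refine (ht ht0).congr_deriv ?_
    rw [(M i).a_zero, neg_zero, zero_mul, zero_add, h.v_eq ht0.le]

variable {q : ℝ → Config M H G} {p : EuclideanSpace ℝ (Fin n) × EuclideanSpace ℝ (Fin r) ×
  EuclideanSpace ℝ (Fin m)}

theorem IsRun.storage_deriv (hq : IsRun P q) (hP : P.Assumption) (hp : p ∈ P.kktSet) :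
    ∀ᵐ t : ℝ, 0 < t → ∃ D, HasDerivAt
      (fun s => storage (allBlocks M H G) (equilibrium _ (outputs p)) (q s).2) D t ∧
      D ≤ -dissipation P p (q t) := by
  have hy : ∀ i ∈ range (Sum.inr ∘ Sum.inr : Fin m → Fin n ⊕ Fin r ⊕ Fin m),
      0 ≤ outputs p i := by
    rintro _ ⟨l, rfl⟩
    exact hp.2.2.1 l
  filter_upwards [storage_deriv_le hq.driven hy] with t ht ht0
  obtain ⟨D, hD, hle⟩ := ht ht0
  exact ⟨D, hD, hle.trans (supply_le_neg_dissipation hP hp (hq.consistent t ht0.le))⟩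

theorem dissipation_nonneg (hP : P.Assumption) (hp : p ∈ P.kktSet) {q : Config M H G}
    (hq : q ∈ consistent P) : 0 ≤ dissipation P p q :=
  have h := (dissipation_terms hP hp hq).2.2.1
  h.1.trans h.2

theorem IsRun.antitoneOn_storage (hq : IsRun P q) (hP : P.Assumption) (hp : p ∈ P.kktSet) :
    AntitoneOn (fun s => storage (allBlocks M H G) (equilibrium _ (outputs p)) (q s).2)
      (Ici 0) := by
  refine LocAC.antitoneOn (locAC_storage hq.driven _) ?_
  filter_upwards [hq.storage_deriv hP hp] with t ht ht0
  obtain ⟨D, hD, hle⟩ := ht ht0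
  exact ⟨D, hD, by linarith [dissipation_nonneg hP hp (hq.consistent t ht0.le)]⟩

theorem IsRun.isBounded (hq : IsRun P q) (hP : P.Assumption) (hp : p ∈ P.kktSet) :
    Bornology.IsBounded (q '' Ici 0) := by
  have hz : Bornology.IsBounded ((fun t => (q t).2) '' Ici 0) := by
    refine (isBounded_storage_le (equilibrium _ (outputs p))
      (storage (allBlocks M H G) (equilibrium _ (outputs p)) (q 0).2)).subset ?_
    rintro _ ⟨t, ht, rfl⟩
    exact hq.antitoneOn_storage hP hp (mem_Ici.2 le_rfl) ht ht
  have hx : Bornology.IsBounded ((fun t => (q t).1) '' Ici 0) := by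
    have hcoord : Bornology.IsBounded ((fun t i => (q t).1 i) '' Ici 0) := by
      rw [← Bornology.forall_isBounded_image_eval_iff]
      intro i
      have hcont : Continuous fun z => modulus P i (q 0, z) :=
        (continuous_modulus hP i).comp (by fun_prop)
      obtain ⟨C, hC⟩ := (hz.isCompact_closure.image hcont).isBounded.bddAbove
      refine (Metric.isBounded_closedBall (x := (q 0).1 i) (r := C)).subset ?_
      rintro _ ⟨_, ⟨t, ht, rfl⟩, rfl⟩
      rw [Metric.mem_closedBall, Real.dist_eq]
      exact (abs_sub_le_modulus hP (hq.consistent t ht) (hq.consistent 0 le_rfl) i).trans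
        (hC ⟨_, subset_closure ⟨t, ht, rfl⟩, rfl⟩)
    have := (PiLp.lipschitzWith_toLp 2 fun _ : Fin n => ℝ).isBounded_image hcoord
    rwa [image_image] at this
  refine (hx.prod hz).subset ?_
  rintro _ ⟨t, ht, rfl⟩
  exact ⟨⟨t, ht, rfl⟩, ⟨t, ht, rfl⟩⟩

theorem uniformContinuousOn_comp {X Y : Type*} [PseudoMetricSpace X] [ProperSpace X]
    [UniformSpace Y] {q : ℝ → X} {S : Set ℝ} (hb : Bornology.IsBounded (q '' S))
    (hq : UniformContinuousOn q S) {Ψ : X → Y} (hΨ : Continuous Ψ) :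
    UniformContinuousOn (fun t => Ψ (q t)) S :=
  (hb.isCompact_closure.uniformContinuousOn_of_continuous hΨ.continuousOn).comp hq
    fun t ht => subset_closure ⟨t, ht, rfl⟩

theorem uniformContinuousOn_pi_iff {X ι : Type*} [UniformSpace X] {Y : ι → Type*}
    [∀ i, UniformSpace (Y i)] {f : X → ∀ i, Y i} {S : Set X} :
    UniformContinuousOn f S ↔ ∀ i, UniformContinuousOn (fun t => f t i) S := by
  simp only [uniformContinuousOn_iff_restrict, uniformContinuous_pi]
  rfl

/-- The states are Lipschitz because their velocities are bounded, and `modulus` transfers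
uniform continuity from the state to the primal output. -/
theorem IsRun.uniformContinuousOn (hq : IsRun P q) (hP : P.Assumption) (hp : p ∈ P.kktSet) :
    UniformContinuousOn q (Ici 0) := by
  have hb := hq.isBounded hP hp
  have hz : UniformContinuousOn (fun t => (q t).2) (Ici 0) := by
    simp only [uniformContinuousOn_pi_iff]
    intro i k
    have hcont : Continuous fun c : Config M H G =>
        |-(allBlocks M H G i).a k * c.2 i k + (allBlocks M H G i).c k * inputs P c i| := by
      have := continuous_inputs (M := M) (H := H) (G := G) hP i
      fun_prop
    obtain ⟨C, hC⟩ := (hb.isCompact_closure.image hcont).isBounded.bddAbove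
    have hlip := abs_sub_le_of_driven hq.driven i k (C := C)
      fun t ht => hC ⟨_, subset_closure ⟨t, ht, rfl⟩, rfl⟩
    refine (LipschitzOnWith.of_dist_le_mul (K := C.toNNReal) fun s hs t ht => ?_).uniformContinuousOn
    rw [Real.dist_eq, Real.dist_eq]
    exact (hlip s hs t ht).trans
      (mul_le_mul_of_nonneg_right (Real.le_coe_toNNReal C) (abs_nonneg _))
  have hx : UniformContinuousOn (fun t => (q t).1) (Ici 0) := by
    have hcoord : UniformContinuousOn (fun t i => (q t).1 i) (Ici 0) := by
      rw [uniformContinuousOn_pi_iff]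
      intro i
      rw [Metric.uniformContinuousOn_iff] at hz ⊢
      intro ε hε
      have huc := (hb.prod (hb.image_snd)).isCompact_closure.uniformContinuousOn_of_continuous
        (continuous_modulus (P := P) hP i).continuousOn
      obtain ⟨η, hη, hηq⟩ := Metric.uniformContinuousOn_iff.1 huc ε hε
      obtain ⟨δ, hδ, hδz⟩ := hz η hη
      refine ⟨δ, hδ, fun t ht s hs hts => ?_⟩
      have hmem : ∀ u : ℝ, 0 ≤ u → (q s, (q u).2) ∈
          closure ((q '' Ici 0) ×ˢ (Prod.snd '' (q '' Ici 0))) := fun u hu =>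
        subset_closure ⟨⟨s, hs, rfl⟩, ⟨q u, ⟨u, hu, rfl⟩, rfl⟩⟩
      have hd := hηq _ (hmem t ht) _ (hmem s hs) (by
        rw [Prod.dist_eq, dist_self, max_eq_right dist_nonneg]
        exact hδz t ht s hs hts)
      rw [modulus_self, Real.dist_eq, sub_zero] at hd
      rw [Real.dist_eq]
      exact (abs_sub_le_modulus hP (hq.consistent t ht) (hq.consistent s hs) i).trans_lt
        ((le_abs_self _).trans_lt hd)
    exact (PiLp.lipschitzWith_toLp 2 fun _ : Fin n => ℝ).uniformContinuous.comp_uniformContinuousOn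
      hcoord
  rw [uniformContinuousOn_iff_restrict] at hx hz ⊢
  exact hx.prodMk hz

theorem IsRun.tendsto_dissipation (hq : IsRun P q) (hP : P.Assumption) (hp : p ∈ P.kktSet) :
    Tendsto (fun t => dissipation P p (q t)) atTop (𝓝 0) :=
  tendsto_zero_of_deriv_le_neg (locAC_storage hq.driven _) (fun _ => storage_nonneg _ _)
    (uniformContinuousOn_comp (hq.isBounded hP hp) (hq.uniformContinuousOn hP hp)
      (continuous_dissipation hP p))
    (fun t ht => dissipation_nonneg hP hp (hq.consistent t ht)) (hq.storage_deriv hP hp)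

theorem tendsto_zero_of_mul_sq {α : Type*} {l : Filter α} {w : α → ℝ} {c : ℝ} (hc : 0 < c)
    (h : Tendsto (fun t => c * w t ^ 2) l (𝓝 0)) : Tendsto w l (𝓝 0) := by
  have h1 : Tendsto (fun t => w t ^ 2) l (𝓝 0) := by
    simpa [hc.ne'] using h.const_mul c⁻¹
  rw [tendsto_zero_iff_abs_tendsto_zero]
  simpa [Real.sqrt_sq_eq_abs, Function.comp_def] using h1.sqrt

theorem IsRun.tendsto_lag (hq : IsRun P q) (hP : P.Assumption) (hp : p ∈ P.kktSet)
    (i : Fin n ⊕ Fin r ⊕ Fin m) {k : Fin ((allBlocks M H G i).lags + 1)} (hk : k ≠ 0) :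
    Tendsto (fun t => (q t).2 i k) atTop (𝓝 0) := by
  refine tendsto_zero_of_mul_sq (div_pos (Block.a_pos _ hk) ((allBlocks M H G i).c_pos k)) ?_
  refine squeeze_zero' ?_ ?_ (hq.tendsto_dissipation hP hp) <;>
    filter_upwards [eventually_ge_atTop 0] with t ht
  · exact ((dissipation_terms hP hp (hq.consistent t ht)).1 i k).1
  · exact ((dissipation_terms hP hp (hq.consistent t ht)).1 i k).2

theorem IsRun.tendsto_feedthrough (hq : IsRun P q) (hP : P.Assumption) (hp : p ∈ P.kktSet)
    (i : Fin n) : Tendsto (fun t => (M i).d * vOut P (q t) i) atTop (𝓝 0) := by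
  rcases (M i).d_nonneg.eq_or_lt with h0 | hpos
  · simp [← h0]
  have : Tendsto (fun t => vOut P (q t) i) atTop (𝓝 0) := by
    refine tendsto_zero_of_mul_sq hpos ?_
    refine squeeze_zero' ?_ ?_ (hq.tendsto_dissipation hP hp) <;>
      filter_upwards [eventually_ge_atTop 0] with t ht
    · exact ((dissipation_terms hP hp (hq.consistent t ht)).2.1 i).1
    · exact ((dissipation_terms hP hp (hq.consistent t ht)).2.1 i).2
  simpa using this.const_mul (M i).d

theorem IsRun.tendsto_complementarity (hq : IsRun P q) (hP : P.Assumption) (hp : p ∈ P.kktSet)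
    (l : Fin m) : Tendsto (fun t => lamOut P (q t) l * -P.g l p.1) atTop (𝓝 0) := by
  refine squeeze_zero' ?_ ?_ (hq.tendsto_dissipation hP hp) <;>
    filter_upwards [eventually_ge_atTop 0] with t ht
  · exact ((dissipation_terms hP hp (hq.consistent t ht)).2.2.2 l).1
  · exact ((dissipation_terms hP hp (hq.consistent t ht)).2.2.2 l).2

theorem eq_of_mapClusterPt_of_tendsto {α X Y : Type*} [TopologicalSpace X] [TopologicalSpace Y]
    [T2Space Y] {l : Filter α} {q : α → X} {a : X} (ha : MapClusterPt a l q) {Ψ : X → Y} {y : Y}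
    (hΨ : Continuous Ψ) (h : Tendsto (fun t => Ψ (q t)) l (𝓝 y)) : Ψ a = y := by
  have h1 : MapClusterPt (Ψ a) l (Ψ ∘ q) := ha.continuousAt_comp hΨ.continuousAt
  have h2 : ClusterPt (Ψ a) (𝓝 y) := ClusterPt.mono h1 h
  exact eq_of_nhds_neBot h2

/-- The dissipation controls the distance of `x` to the unique minimizer. -/
theorem IsRun.tendsto_x (hq : IsRun P q) (hP : P.Assumption) (hf : StrictConvexOn ℝ univ P.f)
    (hp : p ∈ P.kktSet) : Tendsto (fun t => (q t).1) atTop (𝓝 p.1) := by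
  have hb : Bornology.IsBounded ((fun t => (q t).1) '' Ici 0) := by
    simpa only [image_image] using (hq.isBounded hP hp).image_fst
  refine hb.isCompact_closure.tendsto_nhds_of_unique_mapClusterPt ?_ fun y _ hy => ?_
  · filter_upwards [eventually_ge_atTop 0] with t ht using subset_closure ⟨t, ht, rfl⟩
  · have hcont : Continuous fun x => inner ℝ (∇ P.f x - ∇ P.f p.1) (x - p.1) := by
      have := hP.lipschitz_f.continuous
      fun_prop
    refine eq_of_inner_gradient_sub_eq_zero hf (hP.contDiff_f.differentiable one_ne_zero)
      (eq_of_mapClusterPt_of_tendsto hy hcont ?_)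
    refine squeeze_zero' ?_ ?_ (hq.tendsto_dissipation hP hp) <;>
      filter_upwards [eventually_ge_atTop 0] with t ht
    · exact (dissipation_terms hP hp (hq.consistent t ht)).2.2.1.1
    · exact (dissipation_terms hP hp (hq.consistent t ht)).2.2.1.2

/-- The integrator states of the primal blocks converge, as their outputs and all other terms of
the outputs do; by Barbalat's lemma, so do their derivatives, to zero. -/
theorem IsRun.tendsto_v (hq : IsRun P q) (hP : P.Assumption) (hf : StrictConvexOn ℝ univ P.f)
    (hp : p ∈ P.kktSet) (i : Fin n) :
    Tendsto (fun t => vOut P (q t) i) atTop (𝓝 0) := by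
  have hlim : Tendsto (fun t => (q t).2 (.inl i) 0) atTop (𝓝 (p.1 i)) := by
    have h1 : Tendsto (fun t => (q t).1 i) atTop (𝓝 (p.1 i)) :=
      ((by fun_prop : Continuous fun x : EuclideanSpace ℝ (Fin n) => x i).tendsto p.1).comp
        (hq.tendsto_x hP hf hp)
    have h2 : Tendsto (fun t => ∑ k : Fin (M i).lags, (q t).2 (.inl i) k.succ) atTop
        (𝓝 (∑ _ : Fin (M i).lags, 0)) :=
      tendsto_finsetSum _ fun k _ => hq.tendsto_lag hP hp (.inl i) (Fin.succ_ne_zero k)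
    have h3 := (h1.sub h2).sub (hq.tendsto_feedthrough hP hp i)
    rw [Finset.sum_const_zero, sub_zero, sub_zero] at h3
    refine h3.congr' ?_
    filter_upwards [eventually_ge_atTop 0] with t ht
    rw [(hq.consistent t ht).1 i]
    have key : ∀ (s : Fin ((M i).lags + 1) → ℝ) (w : ℝ),
        ∑ k, s k + w - ∑ k : Fin (M i).lags, s k.succ - w = s 0 := fun s w => by
      rw [Fin.sum_univ_succ]
      ring
    exact key _ _
  have hcont : Continuous fun c : Config M H G => (M i).c 0 * vOut P c i := by
    have := continuous_vOut (M := M) (H := H) (G := G) hP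
    fun_prop
  have h0 := tendsto_zero_of_hasDerivAt (hq.integrator i).1 hlim
    (uniformContinuousOn_comp (hq.isBounded hP hp) (hq.uniformContinuousOn hP hp) hcont) (by
      filter_upwards [(hq.integrator i).2] with t ht ht0 using ht ht0)
  simpa [((M i).c_pos 0).ne'] using h0.const_mul ((M i).c 0)⁻¹

end Trajectory

/-! ### Convergence -/

section Convergence

variable {n m r : ℕ} {P : Program n m r} {M : Fin n → Block} {H : Fin r → Block}
  {G : Fin m → Block} {q : ℝ → Config M H G} {p : EuclideanSpace ℝ (Fin n) ×
  EuclideanSpace ℝ (Fin r) × EuclideanSpace ℝ (Fin m)} {a : Config M H G}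

/-- The values of `x`, `μ` and `λ` at a configuration. -/
noncomputable def tripleOut (P : Program n m r) (a : Config M H G) :
    EuclideanSpace ℝ (Fin n) × EuclideanSpace ℝ (Fin r) × EuclideanSpace ℝ (Fin m) :=
  (a.1, muOut P a, lamOut P a)

theorem IsRun.fst_eq_of_mapClusterPt (hq : IsRun P q) (hP : P.Assumption)
    (hf : StrictConvexOn ℝ univ P.f) (hp : p ∈ P.kktSet) (ha : MapClusterPt a atTop q) :
    a.1 = p.1 :=
  eq_of_mapClusterPt_of_tendsto ha continuous_fst (hq.tendsto_x hP hf hp)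

theorem IsRun.vOut_eq_zero_of_mapClusterPt (hq : IsRun P q) (hP : P.Assumption)
    (hf : StrictConvexOn ℝ univ P.f) (hp : p ∈ P.kktSet) (ha : MapClusterPt a atTop q) :
    vOut P a = 0 := by
  ext i
  have hcont : Continuous fun c : Config M H G => vOut P c i := by
    have := continuous_vOut (M := M) (H := H) (G := G) hP
    fun_prop
  exact eq_of_mapClusterPt_of_tendsto ha hcont (hq.tendsto_v hP hf hp i)

theorem IsRun.mem_consistent_of_mapClusterPt (hq : IsRun P q) (hP : P.Assumption)
    (ha : MapClusterPt a atTop q) : a ∈ PrimalDual.consistent P := by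
  refine (isClosed_consistent hP).mem_of_mapClusterPt ha ?_
  filter_upwards [eventually_ge_atTop 0] with t ht using hq.consistent t ht

/-- The cluster points of a run are KKT points, as `v` and `λ_l g_l(x*)` tend to zero. -/
theorem IsRun.tripleOut_mem_kktSet (hq : IsRun P q) (hP : P.Assumption)
    (hf : StrictConvexOn ℝ univ P.f) (hp : p ∈ P.kktSet) (ha : MapClusterPt a atTop q) :
    tripleOut P a ∈ P.kktSet := by
  have hx := hq.fst_eq_of_mapClusterPt hP hf hp ha
  refine ⟨?_, ?_, lamOut_nonneg (hq.mem_consistent_of_mapClusterPt hP ha), ?_, fun l => ?_⟩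
  · have hv := hq.vOut_eq_zero_of_mapClusterPt hP hf hp ha
    rw [vOut, Program.v, ← neg_eq_zero] at hv
    rw [← hv, tripleOut]
    abel
  · simpa [tripleOut, hx] using hp.2.1
  · simpa [tripleOut, hx] using hp.2.2.2.1
  · have hcont : Continuous fun c : Config M H G => lamOut P c l * -P.g l p.1 := by
      have h1 := continuous_lamOut (M := M) (H := H) (G := G) hP
      have h2 := fun l => (hP.contDiff_g l).continuous
      fun_prop
    have h0 := eq_of_mapClusterPt_of_tendsto ha hcont (hq.tendsto_complementarity hP hp l)
    simpa [tripleOut, hx] using h0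

/-- The cluster points of a run are equilibria: the lags vanish, and so does every feedthrough
term, `max 0 (g l x)` included. -/
theorem IsRun.snd_eq_equilibrium (hq : IsRun P q) (hP : P.Assumption)
    (hf : StrictConvexOn ℝ univ P.f) (hp : p ∈ P.kktSet) (ha : MapClusterPt a atTop q) :
    a.2 = equilibrium (allBlocks M H G) (outputs (tripleOut P a)) := by
  have hx := hq.fst_eq_of_mapClusterPt hP hf hp ha
  have hlag : ∀ i k, k ≠ 0 → a.2 i k = 0 := fun i k hk =>
    eq_of_mapClusterPt_of_tendsto ha (by fun_prop : Continuous fun c : Config M H G => c.2 i k)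
      (hq.tendsto_lag hP hp i hk)
  have hsum : ∀ i, ∑ k, a.2 i k = a.2 i 0 := fun i =>
    Finset.sum_eq_single 0 (fun k _ hk => hlag i k hk) (by simp)
  have hint : ∀ i, a.2 i 0 = outputs (tripleOut P a) i := by
    rintro (i | j | l) <;> rw [← hsum]
    · have h := (hq.mem_consistent_of_mapClusterPt hP ha).1 i
      rw [hq.vOut_eq_zero_of_mapClusterPt hP hf hp ha] at h
      simpa [outputs, tripleOut] using h.symm
    · have h0 : P.h a.1 = 0 := by rw [hx]; exact hp.2.1
      simp [outputs, tripleOut, muOut, h0]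
    · have h0 : max 0 (P.g l a.1) = 0 := by rw [hx]; exact max_eq_left (hp.2.2.2.1 l)
      simp [outputs, tripleOut, lamOut, h0]
  funext i k
  rcases eq_or_ne k 0 with rfl | hk
  · simp [equilibrium, hint]
  · simp [equilibrium, hk, hlag i k hk]

/-- The storage function relative to the equilibrium at a cluster point is nonincreasing and
comes near zero infinitely often, so it tends to zero. -/
theorem IsRun.tendsto_of_mapClusterPt (hq : IsRun P q) (hP : P.Assumption)
    (hf : StrictConvexOn ℝ univ P.f) (hp : p ∈ P.kktSet) (ha : MapClusterPt a atTop q) :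
    Tendsto q atTop (𝓝 a) := by
  have hkkt := hq.tripleOut_mem_kktSet hP hf hp ha
  have he := hq.snd_eq_equilibrium hP hf hp ha
  have hanti := hq.antitoneOn_storage hP hkkt
  rw [← he] at hanti
  have hcont : Continuous fun c : Config M H G => storage (allBlocks M H G) a.2 c.2 :=
    (continuous_storage a.2).comp continuous_snd
  have hcl : MapClusterPt 0 atTop fun t => storage (allBlocks M H G) a.2 (q t).2 := by
    have := ha.continuousAt_comp hcont.continuousAt
    rwa [storage_self] at this
  have hz := tendsto_of_storage_tendsto_zero
    (tendsto_zero_of_antitoneOn_of_mapClusterPt hanti (fun _ => storage_nonneg _ _) hcl)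
  have hx := hq.tendsto_x hP hf hp
  rw [← hq.fst_eq_of_mapClusterPt hP hf hp ha] at hx
  exact hx.prodMk_nhds hz

end Convergence

end PrimalDual

theorem corollary1 {n m r : ℕ} (P : PrimalDual.Program n m r) (hP : P.Assumption)
    (hKKT : P.kktSet.Nonempty) (hf : StrictConvexOn ℝ Set.univ P.f)
    (M : Fin n → PrimalDual.Block) (H : Fin r → PrimalDual.Block) (G : Fin m → PrimalDual.Block)
    (x : ℝ → EuclideanSpace ℝ (Fin n)) (mu : ℝ → EuclideanSpace ℝ (Fin r))
    (lam : ℝ → EuclideanSpace ℝ (Fin m))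
    (ξ : ∀ i, ℝ → Fin ((M i).lags + 1) → ℝ) (ζ : ∀ j, ℝ → Fin ((H j).lags + 1) → ℝ)
    (ρ : ∀ l, ℝ → Fin ((G l).lags + 1) → ℝ)
    (htraj : PrimalDual.IsTrajectory P M H G x mu lam ξ ζ ρ) :
    ∃ p ∈ P.kktSet,
      Filter.Tendsto (fun t => (x t, mu t, lam t)) Filter.atTop (nhds p) := by
  obtain ⟨p, hp⟩ := hKKT
  have hq := htraj.isRun
  obtain ⟨a, -, ha⟩ := (hq.isBounded hP hp).isCompact_closure.exists_mapClusterPt_of_frequently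
    (l := atTop) (f := PrimalDual.configs x ξ ζ ρ)
    ((eventually_ge_atTop 0).mono fun t ht => subset_closure (mem_image_of_mem _ ht)).frequently
  refine ⟨PrimalDual.tripleOut P a, hq.tripleOut_mem_kktSet hP hf hp ha, ?_⟩
  have hcont : Continuous (PrimalDual.tripleOut P : PrimalDual.Config M H G → _) :=
    continuous_fst.prodMk (PrimalDual.continuous_muOut.prodMk (PrimalDual.continuous_lamOut hP))
  refine ((hcont.tendsto a).comp (hq.tendsto_of_mapClusterPt hP hf hp ha)).congr' ?_
  filter_upwards [eventually_ge_atTop 0] with t ht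
  rw [htraj.mu_eq ht, htraj.lam_eq ht]
  rfl
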